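/- **Setting.** Fix $n\ge 2$ agents, a measurable space $\Omega$ of solutions, and a principal with a measurable utility $x:\Omega\to\mathbb{R}_{>0}$. Each agent $i$ observes $k\ge 1$ solutions $\omega_{i,1},\dots,\omega_{i,k}\in\Omega$ and has a utility $y_i:\Omega\to\mathbb{R}_{>0}$. The agents are symmetric: all $nk$ solutions are independent draws from one probability distribution $P$ on $\Omega$. Write $D$ for the law of $X_{i,j}=x(\omega_{i,j})$, and $D_{\max}$ for the law of $X_{i,(1)}=\max_{j\le k}X_{i,j}$, i.e. of the maximum of $k$ independent draws from $D$. A *multi-agent single-proposal mechanism* consists of an eligible set $R_i\subseteq\Omega$ for each agent $i$ and a deterministic tie-breaking rule that picks one agent out of each nonempty set of tied agents. Each agent proposes at most one of his own observed solutions; a proposal of agent $i$ outside $R_i$ is discarded; among the remaining candidates the winner is one that maximizes $x$, ties being broken by the rule. If $\omega$, proposed by agent $i$, wins, the principal gets $x(\omega)$, agent $i$ gets $y_i(\omega)$ and all other agents get $0$; if there is no candidate, everybody gets $0$. Information is complete: all agents see the whole realization $\bar\omega=(\omega_{i,j})$ and then play a (possibly mixed) Nash equilibrium of the game that the mechanism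 induces at $\bar\omega$. The mechanism has *additive price of anarchy at most $\gamma$* if, for every selection of a Nash equilibrium at (almost) every realization, the principal's expected utility (over $\bar\omega$ and the agents' randomization) plus $\gamma$ is at least $\mathbb{E}[\max_{i,j}X_{i,j}]$. (For a non-measurable selection the expected utility is the lower integral.) **Theorem.** 1. There is a multi-agent single-proposal mechanism, which may depend on $n$, $\Omega$ and $x$ but not on $P$, $k$ or the $y_i$ (so it is prior-independent), such that for every $k\ge 1$, all utilities $y_i:\Omega\to\mathbb{R}_{>0}$, and every $P$ for which $D$ has a probability density function that vanishes outside some interval and is nondecreasing on that interval, its additive price of anarchy is at most $$\frac{\sqrt{12\,\mathrm{Var}(D_{\max})}}{n+1}.$$ 2. The uniform distribution $D=U[0,1]$ has such a density, and for it, for all $k\ge1$, $$\frac{\sqrt{12\,\mathrm{Var}(D_{\max})}}{n+1}=\frac{1}{n+1}\sqrt{\frac{12k}{(k+1)^2(k+2)}}\le\frac{\sqrt{12}}{k(n+1)},$$ where the ratio of the two sides of the inequality tends to $1$ as $k\to\infty$; here $|\sqrt{12}-3.464|<0.0005$, so the factor is approximately $3.464/(k(n+1))$. -/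

import Mathlib

open MeasureTheory ProbabilityTheory Filter Topology
open scoped ENNReal

noncomputable section

namespace Delegation

/-- A multi-agent single-proposal mechanism for `n` agents: an eligible set for every agent and a
deterministic tie-breaking rule, which picks one agent out of any nonempty set of tied agents. -/
structure MSPM (n : ℕ) (Ω : Type*) where
  eligible : Fin n → Set Ω
  tieBreak : Finset (Fin n) → Fin n
  tieBreak_mem : ∀ s : Finset (Fin n), s.Nonempty → tieBreak s ∈ s

/-- The observed solutions: `w i j` is the `j`-th solution of agent `i`. -/
abbrev Solutions (n k : ℕ) (Ω : Type*) : Type _ := Fin n → Fin k → Ω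

/-- An action profile: every agent proposes (the index of) one of his own observed solutions,
or proposes nothing. -/
abbrev Actions (n k : ℕ) : Type := Fin n → Option (Fin k)

/-- A profile of mixed strategies (at a given realization): `p i a` is the probability with which
agent `i` plays `a`. -/
abbrev Mixed (n k : ℕ) : Type := Fin n → Option (Fin k) → ℝ

/-- The solution that agent `i` submits, if any. -/
def proposal {n k : ℕ} {Ω : Type*} (w : Solutions n k Ω) (a : Actions n k) (i : Fin n) :
    Option Ω :=
  (a i).map (w i)

namespace MSPM

variable {n k : ℕ} {Ω : Type*}

/-- `v` is the candidate of agent `i`: he submitted it and it passes the filter. -/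
def IsCandidate (M : MSPM n Ω) (b : Fin n → Option Ω) (i : Fin n) (v : Ω) : Prop :=
  b i = some v ∧ v ∈ M.eligible i

open Classical in
/-- The agents whose candidates maximize the principal's utility `x` among all candidates. -/
def best (M : MSPM n Ω) (x : Ω → ℝ) (b : Fin n → Option Ω) : Finset (Fin n) :=
  Finset.univ.filter fun i =>
    ∃ v, M.IsCandidate b i v ∧ ∀ j v', M.IsCandidate b j v' → x v' ≤ x v

open Classical in
/-- The agent who owns the winner; `none` stands for the null outcome (there is no candidate). -/
def winner (M : MSPM n Ω) (x : Ω → ℝ) (b : Fin n → Option Ω) : Option (Fin n) :=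
  if (M.best x b).Nonempty then some (M.tieBreak (M.best x b)) else none

/-- The principal's realized utility: `x` of the winner, and `0` for the null outcome. -/
def principalUtility (M : MSPM n Ω) (x : Ω → ℝ) (b : Fin n → Option Ω) : ℝ :=
  match M.winner x b with
  | none => 0
  | some i => (b i).elim 0 x

open Classical in
/-- Agent `i`'s realized utility: `y i` of the winner if he owns it, and `0` otherwise. -/
def agentUtility (M : MSPM n Ω) (x : Ω → ℝ) (y : Fin n → Ω → ℝ) (b : Fin n → Option Ω)
    (i : Fin n) : ℝ :=
  if M.winner x b = some i then (b i).elim 0 (y i) else 0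

end MSPM

/-- The expectation of `g` when the agents independently play the mixed strategies `p`. -/
def expect {n k : ℕ} (p : Mixed n k) (g : Actions n k → ℝ) : ℝ :=
  ∑ a : Actions n k, (∏ i, p i (a i)) * g a

namespace MSPM

variable {n k : ℕ} {Ω : Type*}

/-- `p` is a (mixed) Nash equilibrium of the complete-information game that `M` induces at the
commonly known realization `w`. -/
def IsNash (M : MSPM n Ω) (x : Ω → ℝ) (y : Fin n → Ω → ℝ) (w : Solutions n k Ω)
    (p : Mixed n k) : Prop :=
  (∀ i, p i ∈ stdSimplex ℝ (Option (Fin k))) ∧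
    ∀ i, ∀ q ∈ stdSimplex ℝ (Option (Fin k)),
      expect (Function.update p i q) (fun a => M.agentUtility x y (proposal w a) i) ≤
        expect p (fun a => M.agentUtility x y (proposal w a) i)

end MSPM

/-- The law of the observed solutions of symmetric agents: `n * k` independent draws from `P`. -/
def solutionsLaw {Ω : Type*} [MeasurableSpace Ω] (n k : ℕ) (P : Measure Ω) :
    Measure (Solutions n k Ω) :=
  Measure.pi fun _ : Fin n => Measure.pi fun _ : Fin k => P

/-- The benchmark: the expected utility of the best of all observed solutions. -/
def opt {Ω : Type*} [MeasurableSpace Ω] (n k : ℕ) (P : Measure Ω) (x : Ω → ℝ) : ℝ≥0∞ :=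
  ∫⁻ w, ENNReal.ofReal (⨆ i : Fin n, ⨆ j : Fin k, x (w i j)) ∂(solutionsLaw n k P)

/-- `M` has additive price of anarchy (at most) `γ`: whenever the agents play a Nash equilibrium at
almost every realization, the expected utility of the principal is at least `opt - γ`.
Utilities are nonnegative, so expectations are lower integrals in `[0, ∞]`; for an equilibrium
selection `σ` that is measurable this is the usual expectation, and for others it is the smallest
sensible one. -/
def MSPM.HasAdditivePoA {n : ℕ} {Ω : Type*} [MeasurableSpace Ω] (M : MSPM n Ω) (x : Ω → ℝ)
    (y : Fin n → Ω → ℝ) (k : ℕ) (P : Measure Ω) (γ : ℝ) : Prop :=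
  ∀ σ : Solutions n k Ω → Mixed n k,
    (∀ᵐ w ∂(solutionsLaw n k P), M.IsNash x y w (σ w)) →
      opt n k P x ≤
        (∫⁻ w, ENNReal.ofReal (expect (σ w) fun a => M.principalUtility x (proposal w a))
          ∂(solutionsLaw n k P)) + ENNReal.ofReal γ

/-- `D` has a probability density function that is nondecreasing on the interval that carries it. -/
def HasNondecreasingDensity (D : Measure ℝ) : Prop :=
  ∃ (f : ℝ → ℝ≥0∞) (I : Set ℝ), Measurable f ∧ I.OrdConnected ∧ MonotoneOn f I ∧
    (∀ t ∉ I, f t = 0) ∧ D = volume.withDensity f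

/-- The law of the maximum of `k` independent draws from `D`. -/
def maxLaw (D : Measure ℝ) (k : ℕ) : Measure ℝ :=
  (Measure.pi fun _ : Fin k => D).map fun v => ⨆ j, v j

/-- The approximation factor `√(12 Var(D_max)) / (n + 1)`. -/
def factor (D : Measure ℝ) (n k : ℕ) : ℝ :=
  √(12 * Var[id; maxLaw D k]) / (n + 1)

/-- The uniform distribution on `[0, 1]`. -/
def uniform01 : Measure ℝ := volume.restrict (Set.Icc 0 1)

end Delegation

end

noncomputable section

namespace Delegation

/-! No filter is needed: every solution is made eligible. Almost surely different agents have
solutions of different values. Suppose a supported profile gives the principal less than two agents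
could each offer. Compare the least valuable action in the support of each of the two: the lower one
never wins, while its owner would win against that profile by proposing his better solution, so he
would deviate (`le_principalUtility_of_isNash`). Hence the principal loses at most the gap between
the best and the second best of `n` independent draws from `D_max`.

Let `G` be the cdf of `D_max`. The expected gap is `n ∫ (1 - G) G^(n-1) dt`. The law `D_max`
inherits a nondecreasing density `g`. The function `h(u) = n (u^(n-1) - u^n) - 6/(n+1) (u - u^2)`
has integral `0` over `[0,1]` and changes sign at most once, from minus to plus. Since `G(X)` is
uniform for `X` distributed as `D_max`, `∫ h(G) g dt = 0`; replacing `g` by its value at the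
crossing can only lower this integral, so `∫ h(G) dt ≤ 0` (`integral_comp_cdf_nonpos`). It remains
to bound `∫ G (1 - G) dt`, which equals `2 Cov(X, G(X))`. By Cauchy–Schwarz and `Var G(X) = 1/12`
this is at most `2 √(Var X / 12)`, and multiplying by `6/(n+1)` gives the factor
(`integral_gap_le`). -/

open Classical in
/-- The mechanism without a filter: every solution is eligible. -/
def openMSPM (n : ℕ) (hn : 0 < n) (Ω : Type*) : MSPM n Ω where
  eligible _ := Set.univ
  tieBreak s := if h : s.Nonempty then h.choose else ⟨0, hn⟩
  tieBreak_mem s h := by rw [dif_pos h]; exact h.choose_spec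

/-! ### Equilibria of the game without a filter. -/

variable {n k : ℕ} {Ω : Type*} {M : MSPM n Ω} {x : Ω → ℝ}

/-- The value of an action to the principal: `0` for proposing nothing. -/
def actionValue (x : Ω → ℝ) (w : Solutions n k Ω) (i : Fin n) (c : Option (Fin k)) : ℝ :=
  c.elim 0 fun j => x (w i j)

namespace MSPM

lemma best_nonempty (hM : ∀ i, M.eligible i = Set.univ) {b : Fin n → Option Ω} {i : Fin n} {v : Ω}
    (hb : b i = some v) : (M.best x b).Nonempty := by
  classical
  obtain ⟨j, hj, hmax⟩ := Finset.exists_max_image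
    (Finset.univ.filter fun j => (b j).isSome) (fun j => (b j).elim 0 x)
    ⟨i, by simp [hb]⟩
  simp only [Finset.mem_filter, Finset.mem_univ, true_and] at hj hmax
  obtain ⟨u, hu⟩ := Option.isSome_iff_exists.1 hj
  refine ⟨j, Finset.mem_filter.2 ⟨Finset.mem_univ _, u, ⟨hu, by simp [hM]⟩, ?_⟩⟩
  rintro l v' ⟨hv', -⟩
  simpa [hu, hv'] using hmax l (by simp [hv'])

lemma le_of_winner {b : Fin n → Option Ω} {i : Fin n} (hM : ∀ i, M.eligible i = Set.univ)
    (hi : M.winner x b = some i) :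
    ∃ v, b i = some v ∧ ∀ j v', b j = some v' → x v' ≤ x v := by
  classical
  unfold winner at hi
  split_ifs at hi with h
  have hmem := M.tieBreak_mem _ h
  rw [Option.some.inj hi] at hmem
  obtain ⟨v, hv, hle⟩ := (Finset.mem_filter.1 hmem).2
  exact ⟨v, hv.1, fun j v' hj => hle j v' ⟨hj, by simp [hM]⟩⟩

lemma exists_winner (hM : ∀ i, M.eligible i = Set.univ) {b : Fin n → Option Ω} {i : Fin n} {v : Ω}
    (hb : b i = some v) : ∃ j, M.winner x b = some j :=
  ⟨_, if_pos (best_nonempty hM hb)⟩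

lemma principalUtility_nonneg (hxpos : ∀ v, 0 < x v) (b : Fin n → Option Ω) :
    0 ≤ M.principalUtility x b := by
  unfold principalUtility
  split
  · exact le_rfl
  · rename_i i _
    cases b i with
    | none => exact le_rfl
    | some v => exact (hxpos v).le

lemma actionValue_le_principalUtility (hM : ∀ i, M.eligible i = Set.univ) (hxpos : ∀ v, 0 < x v)
    (w : Solutions n k Ω) (a : Actions n k) (i : Fin n) :
    actionValue x w i (a i) ≤ M.principalUtility x (proposal w a) := by
  cases h : a i with
  | none => exact principalUtility_nonneg hxpos _
  | some c =>
    have hb : proposal w a i = some (w i c) := by simp [proposal, h]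
    obtain ⟨j, hj⟩ := exists_winner (x := x) hM hb
    obtain ⟨v, hv, hle⟩ := le_of_winner hM hj
    simpa [principalUtility, hj, hv, actionValue] using hle i _ hb

variable {y : Fin n → Ω → ℝ}

lemma agentUtility_nonneg (hy : ∀ i v, 0 < y i v) (b : Fin n → Option Ω) (i : Fin n) :
    0 ≤ M.agentUtility x y b i := by
  unfold agentUtility
  split_ifs
  · cases b i with
    | none => exact le_rfl
    | some v => exact (hy i v).le
  · exact le_rfl

lemma agentUtility_eq_zero (hM : ∀ i, M.eligible i = Set.univ) (hxpos : ∀ v, 0 < x v)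
    {w : Solutions n k Ω} {a : Actions n k} {i : Fin n}
    (h : a i = none ∨ ∃ j, actionValue x w i (a i) < actionValue x w j (a j)) :
    M.agentUtility x y (proposal w a) i = 0 := by
  unfold agentUtility
  refine if_neg fun hi => ?_
  obtain ⟨v, hv, hle⟩ := le_of_winner hM hi
  rcases h with h | ⟨j, hj⟩
  · simp [proposal, h] at hv
  · obtain ⟨c, hc, rfl⟩ : ∃ c, a i = some c ∧ w i c = v := by simpa [proposal] using hv
    rw [hc] at hj
    cases hd : a j with
    | none => rw [hd] at hj; exact absurd hj (hxpos _).not_gt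
    | some d =>
      rw [hd] at hj
      exact absurd (hle j (w j d) (by simp [proposal, hd])) hj.not_ge

lemma agentUtility_pos (hM : ∀ i, M.eligible i = Set.univ) (hy : ∀ i v, 0 < y i v)
    {w : Solutions n k Ω} {a : Actions n k} {i : Fin n} {c : Fin k} (hc : a i = some c)
    (h : ∀ j ≠ i, actionValue x w j (a j) < x (w i c)) :
    0 < M.agentUtility x y (proposal w a) i := by
  have hb : proposal w a i = some (w i c) := by simp [proposal, hc]
  obtain ⟨j, hj⟩ := exists_winner (x := x) hM hb
  obtain ⟨v, hv, hle⟩ := le_of_winner hM hj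
  obtain rfl : j = i := by
    by_contra hne
    obtain ⟨d, hd, rfl⟩ : ∃ d, a j = some d ∧ w j d = v := by simpa [proposal] using hv
    have := h j hne
    rw [hd] at this
    exact absurd (hle i _ hb) this.not_ge
  simp [agentUtility, hj, hb, hy]

end MSPM

/-- Isolating the probability of agent `i`'s own action lets a deviation be compared with `p`
profile by profile. -/
lemma expect_update (p : Mixed n k) (i : Fin n) (q : Option (Fin k) → ℝ) (g : Actions n k → ℝ) :
    expect (Function.update p i q) g =
      ∑ a : Actions n k, q (a i) * (∏ j ∈ Finset.univ.erase i, p j (a j)) * g a := by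
  refine Finset.sum_congr rfl fun a _ => ?_
  rw [← Finset.mul_prod_erase _ _ (Finset.mem_univ i), Function.update_self]
  congr 2
  refine Finset.prod_congr rfl fun j hj => ?_
  rw [Function.update_of_ne (Finset.ne_of_mem_erase hj)]

variable {y : Fin n → Ω → ℝ}

/-- A pure action `l` that gives agent `i` nothing is not played if some action `c` gives him
something. -/
lemma isNash_support {w : Solutions n k Ω} {p : Mixed n k} (hp : M.IsNash x y w p)
    (hy : ∀ i v, 0 < y i v) {i : Fin n} {l c : Option (Fin k)} (hlc : l ≠ c) (hl : 0 < p i l)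
    (hzero : ∀ a : Actions n k, a i = l → (∀ j ≠ i, 0 < p j (a j)) →
      M.agentUtility x y (proposal w a) i = 0)
    (a₀ : Actions n k) (hac : a₀ i = c) (ha₀ : ∀ j ≠ i, 0 < p j (a₀ j))
    (hpos : 0 < M.agentUtility x y (proposal w a₀) i) : False := by
  classical
  have hnn : ∀ j d, 0 ≤ p j d := fun j d => (hp.1 j).1 d
  -- The deviation moves all the mass of `l` to `c`.
  set q : Option (Fin k) → ℝ := fun d =>
    p i d + p i l * ((if d = c then 1 else 0) - (if d = l then 1 else 0)) with hq
  have hqs : q ∈ stdSimplex ℝ (Option (Fin k)) := by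
    refine ⟨fun d => ?_, ?_⟩
    · have h1 := hnn i d
      have h2 : 0 ≤ p i l * (if d = c then 1 else 0) := mul_nonneg hl.le (by split_ifs <;> norm_num)
      by_cases hd : d = l
      · subst hd; simp [hq, hlc]
      · simp only [hq, hd, if_false, sub_zero]; exact add_nonneg h1 h2
    · simp only [hq, Finset.sum_add_distrib, ← Finset.mul_sum, Finset.sum_sub_distrib]
      simp [(hp.1 i).2]
  have key := hp.2 i q hqs
  rw [← Function.update_eq_self i p, Function.update_idem, expect_update, expect_update,
    ← sub_nonpos, ← Finset.sum_sub_distrib] at key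
  refine absurd key (not_le.2 ?_)
  -- No profile loses from the move: mass is removed only from `l`, where either the utility or the
  -- probability of the others' actions is zero.
  have hterm : ∀ a : Actions n k,
      0 ≤ q (a i) * (∏ j ∈ Finset.univ.erase i, p j (a j)) * M.agentUtility x y (proposal w a) i
        - p i (a i) * (∏ j ∈ Finset.univ.erase i, p j (a j)) *
          M.agentUtility x y (proposal w a) i := by
    intro a
    have hprod : 0 ≤ ∏ j ∈ Finset.univ.erase i, p j (a j) := Finset.prod_nonneg fun j _ => hnn _ _
    have hu := MSPM.agentUtility_nonneg (M := M) (x := x) hy (proposal w a) i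
    by_cases hal : a i = l
    · have : (∏ j ∈ Finset.univ.erase i, p j (a j)) * M.agentUtility x y (proposal w a) i = 0 := by
        by_cases hall : ∀ j ≠ i, 0 < p j (a j)
        · rw [hzero a hal hall, mul_zero]
        · push Not at hall
          obtain ⟨j, hj, hj0⟩ := hall
          rw [Finset.prod_eq_zero (Finset.mem_erase.2 ⟨hj, Finset.mem_univ j⟩)
            (le_antisymm hj0 (hnn _ _)), zero_mul]
      rw [mul_assoc, mul_assoc, this]; simp
    · rw [← sub_mul, ← sub_mul]
      refine mul_nonneg (mul_nonneg ?_ hprod) hu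
      simp only [hq, hal, if_false, sub_zero, add_sub_cancel_left]
      exact mul_nonneg hl.le (by split_ifs <;> norm_num)
  refine Finset.sum_pos' (fun a _ => hterm a) ⟨a₀, Finset.mem_univ _, ?_⟩
  have hprod : 0 < ∏ j ∈ Finset.univ.erase i, p j (a₀ j) :=
    Finset.prod_pos fun j hj => ha₀ j (Finset.ne_of_mem_erase hj)
  rw [← sub_mul, ← sub_mul]
  refine mul_pos (mul_pos ?_ hprod) hpos
  simp [hq, hac, hlc.symm, hl]

/-- In equilibrium the principal is sure to get what each of two different agents can offer, or
more. -/
lemma le_principalUtility_of_isNash (hM : ∀ i, M.eligible i = Set.univ) (hxpos : ∀ v, 0 < x v)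
    (hy : ∀ i v, 0 < y i v) {w : Solutions n k Ω}
    (htie : ∀ i j, i ≠ j → ∀ c d, x (w i c) ≠ x (w j d)) {p : Mixed n k}
    (hp : M.IsNash x y w p) {i j : Fin n} (hij : i ≠ j) {c d : Fin k} {m : ℝ}
    (hc : m ≤ x (w i c)) (hd : m ≤ x (w j d)) {a : Actions n k} (ha : ∀ l, 0 < p l (a l)) :
    m ≤ M.principalUtility x (proposal w a) := by
  classical
  by_contra! hlt
  have hval : ∀ l, actionValue x w l (a l) < m := fun l =>
    (MSPM.actionValue_le_principalUtility hM hxpos w a l).trans_lt hlt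
  -- `e l` is the supported action of agent `l` that is worst for the principal; its value is below
  -- `m` because that of `a l` is.
  have hmin : ∀ l, ∃ e, 0 < p l e ∧
      ∀ e', 0 < p l e' → actionValue x w l e ≤ actionValue x w l e' := by
    intro l
    obtain ⟨e, he, hle⟩ := Finset.exists_min_image (Finset.univ.filter fun e => 0 < p l e)
      (actionValue x w l) ⟨a l, by simp [ha]⟩
    exact ⟨e, by simpa using he, fun e' he' => hle e' (by simpa using he')⟩
  choose e he hle using hmin
  -- With the lower minimum, `e i` is strictly beaten by every supported action of `j`, because ties
  -- are excluded; against `a`, proposing `c` wins outright.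
  have main : ∀ i j, i ≠ j → ∀ c : Fin k, m ≤ x (w i c) →
      actionValue x w i (e i) ≤ actionValue x w j (e j) → False := by
    intro i j hij c hc hee
    have hec : actionValue x w i (e i) < x (w i c) :=
      ((hle i _ (ha i)).trans_lt (hval i)).trans_le hc
    refine isNash_support hp hy (i := i) (l := e i) (c := some c) ?_ (he i) ?_
      (Function.update a i (some c)) (by simp) ?_ ?_
    · intro h; rw [h] at hec; exact lt_irrefl _ hec
    · intro b hb hbp
      refine MSPM.agentUtility_eq_zero hM hxpos ?_
      rw [or_iff_not_imp_left]
      intro hne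
      refine ⟨j, lt_of_le_of_ne ?_ ?_⟩
      · rw [hb]; exact hee.trans (hle j _ (hbp j hij.symm))
      · obtain ⟨f, hf⟩ := Option.ne_none_iff_exists'.1 hne
        rw [hf]
        cases hg : b j with
        | none => exact (hxpos _).ne'
        | some g => exact htie i j hij f g
    · intro l hl; rw [Function.update_of_ne hl]; exact ha l
    · refine MSPM.agentUtility_pos hM hy (c := c) (by simp) ?_
      intro l hl; rw [Function.update_of_ne hl]; exact (hval l).trans_le hc
  rcases le_total (actionValue x w i (e i)) (actionValue x w j (e j)) with h | h
  · exact main i j hij c hc h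
  · exact main j i hij.symm d hd h

lemma sum_prod_mixed {p : Mixed n k} (hp : ∀ i, p i ∈ stdSimplex ℝ (Option (Fin k))) :
    ∑ a : Actions n k, ∏ i, p i (a i) = 1 := by
  classical
  rw [← Fintype.piFinset_univ, ← Finset.prod_univ_sum]
  exact Finset.prod_eq_one fun i _ => (hp i).2

lemma le_expect {p : Mixed n k} (hp : ∀ i, p i ∈ stdSimplex ℝ (Option (Fin k))) {m : ℝ}
    {g : Actions n k → ℝ} (hg : ∀ a, (∀ i, 0 < p i (a i)) → m ≤ g a) : m ≤ expect p g := by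
  rw [← one_mul m, ← sum_prod_mixed hp, Finset.sum_mul]
  refine Finset.sum_le_sum fun a _ => ?_
  by_cases ha : ∀ i, 0 < p i (a i)
  · exact mul_le_mul_of_nonneg_left (hg a ha) (Finset.prod_nonneg fun i _ => (ha i).le)
  · push Not at ha
    obtain ⟨i, hi⟩ := ha
    rw [Finset.prod_eq_zero (Finset.mem_univ i) (le_antisymm hi ((hp i).1 _)), zero_mul, zero_mul]

/-- In equilibrium the principal's expected utility is at least the best solution of the second
best agent. -/
lemma le_expect_principalUtility (hM : ∀ i, M.eligible i = Set.univ) (hxpos : ∀ v, 0 < x v)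
    (hy : ∀ i v, 0 < y i v) {w : Solutions n k Ω}
    (htie : ∀ i j, i ≠ j → ∀ c d, x (w i c) ≠ x (w j d)) {p : Mixed n k}
    (hp : M.IsNash x y w p) {i j : Fin n} (hij : i ≠ j) {c d : Fin k} {m : ℝ}
    (hc : m ≤ x (w i c)) (hd : m ≤ x (w j d)) :
    m ≤ expect p fun a => M.principalUtility x (proposal w a) :=
  le_expect hp.1 fun _ ha => le_principalUtility_of_isNash hM hxpos hy htie hp hij hc hd ha

/-! ### The probability integral transform for atomless laws. -/

section Cdf

variable {μ : Measure ℝ} [IsProbabilityMeasure μ]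

lemma continuous_cdf [NullSingletonClass μ] : Continuous (cdf μ) := by
  rw [continuous_iff_continuousAt]
  intro t
  rw [continuousAt_iff_continuous_left'_right']
  refine ⟨?_, ((cdf μ).right_continuous t).mono Set.Ioi_subset_Ici_self⟩
  rw [(cdf μ).mono.continuousWithinAt_Iio_iff_leftLim_eq]
  have h : (cdf μ).measure {t} = 0 := by rw [measure_cdf]; exact measure_singleton t
  rw [StieltjesFunction.measure_singleton, ENNReal.ofReal_eq_zero] at h
  exact le_antisymm ((cdf μ).mono.leftLim_le le_rfl) (by linarith)

lemma exists_cdf_eq [NullSingletonClass μ] {u : ℝ} (h0 : 0 < u) (h1 : u < 1) : ∃ t, cdf μ t = u := by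
  obtain ⟨a, ha⟩ := ((tendsto_cdf_atBot μ).eventually_lt_const h0).exists
  obtain ⟨b, hb⟩ := ((tendsto_cdf_atTop μ).eventually_const_lt h1).exists
  exact mem_range_of_exists_le_of_exists_ge continuous_cdf ⟨a, ha.le⟩ ⟨b, hb.le⟩

/-- The cdf may be flat and so need not have an inverse. By continuity its sublevel set is a closed
half-line, at whose endpoint the cdf still equals `u`. -/
lemma measure_cdf_le [NullSingletonClass μ] {u : ℝ} (h0 : 0 < u) (h1 : u < 1) :
    μ {s | cdf μ s ≤ u} = ENNReal.ofReal u := by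
  set S := {s | cdf μ s ≤ u}
  have hne : S.Nonempty := let ⟨t, ht⟩ := exists_cdf_eq (μ := μ) h0 h1; ⟨t, ht.le⟩
  obtain ⟨b, hb⟩ := ((tendsto_cdf_atTop μ).eventually_const_lt h1).exists
  have hbdd : BddAbove S := ⟨b, fun s hs => le_of_not_gt fun hlt =>
    (hb.trans_le (monotone_cdf μ hlt.le)).not_ge hs⟩
  have hcl : IsClosed S := isClosed_le continuous_cdf continuous_const
  have hmem : cdf μ (sSup S) ≤ u := hcl.csSup_mem hne hbdd
  have hS : S = Set.Iic (sSup S) := Set.Subset.antisymm (fun s hs => le_csSup hbdd hs)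
    fun s hs => (monotone_cdf μ hs).trans hmem
  have heq : cdf μ (sSup S) = u := by
    obtain ⟨t, ht⟩ := exists_cdf_eq (μ := μ) h0 h1
    exact le_antisymm hmem (ht ▸ monotone_cdf μ (le_csSup hbdd ht.le))
  rw [hS, ← ofReal_cdf, heq]

lemma uniform01_Iic {u : ℝ} (h1 : u ≤ 1) : uniform01 (Set.Iic u) = ENNReal.ofReal u := by
  rw [uniform01, Measure.restrict_apply measurableSet_Iic]
  have : Set.Iic u ∩ Set.Icc (0 : ℝ) 1 = Set.Icc 0 u := by
    ext t; simp only [Set.mem_inter_iff, Set.mem_Iic, Set.mem_Icc]; grind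
  rw [this, Real.volume_Icc, sub_zero]

instance : IsProbabilityMeasure uniform01 := ⟨by simp [uniform01]⟩

instance : NullSingletonClass uniform01 := by unfold uniform01; infer_instance

/-- The probability integral transform. -/
lemma map_cdf [NullSingletonClass μ] : μ.map (cdf μ) = uniform01 := by
  have hm : Measurable (cdf μ) := (monotone_cdf μ).measurable
  have : IsProbabilityMeasure (μ.map (cdf μ)) := Measure.isProbabilityMeasure_map hm.aemeasurable
  have pos : ∀ u : ℝ, 0 < u → μ.map (cdf μ) (Set.Iic u) = uniform01 (Set.Iic u) := by
    intro u h0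
    rcases lt_or_ge u 1 with h1 | h1
    · rw [uniform01_Iic h1.le, Measure.map_apply hm measurableSet_Iic]
      exact measure_cdf_le h0 h1
    · rw [Measure.map_apply hm measurableSet_Iic]
      have e : cdf μ ⁻¹' Set.Iic u = Set.univ :=
        Set.eq_univ_of_forall fun s => (cdf_le_one μ s).trans h1
      rw [e, measure_univ]
      refine le_antisymm ?_ prob_le_one
      calc (1 : ℝ≥0∞) = uniform01 (Set.Iic 1) := by rw [uniform01_Iic le_rfl, ENNReal.ofReal_one]
        _ ≤ _ := measure_mono (Set.Iic_subset_Iic.2 h1)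
  refine Measure.ext_of_Iic _ _ fun u => ?_
  rcases lt_or_ge 0 u with h0 | h0
  · exact pos u h0
  · have hle : ∀ ν : Measure ℝ, ν (Set.Iic u) ≤ ν (Set.Iic 0) :=
      fun ν => measure_mono (Set.Iic_subset_Iic.2 h0)
    have hz : uniform01 (Set.Iic 0) = 0 := by rw [uniform01_Iic zero_le_one, ENNReal.ofReal_zero]
    -- The level `0` need not be attained by the cdf, so it is squeezed by small positive levels.
    have hz' : μ.map (cdf μ) (Set.Iic 0) = 0 := by
      refine le_antisymm (ENNReal.le_of_forall_pos_le_add fun ε hε _ => ?_) zero_le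
      rw [zero_add]
      set δ : ℝ := min ε 1
      have hδ : 0 < δ := lt_min hε one_pos
      calc μ.map (cdf μ) (Set.Iic 0) ≤ μ.map (cdf μ) (Set.Iic δ) :=
            measure_mono (Set.Iic_subset_Iic.2 hδ.le)
        _ = ENNReal.ofReal δ := by rw [pos δ hδ, uniform01_Iic (min_le_right _ _)]
        _ ≤ ENNReal.ofReal ε := ENNReal.ofReal_le_ofReal (min_le_left _ _)
        _ = ε := ENNReal.ofReal_coe_nnreal
    rw [le_antisymm ((hle _).trans hz.le) zero_le,
      le_antisymm ((hle _).trans hz'.le) zero_le]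

/-- The half-line lies in the sublevel set and has the same mass; they differ only by a null stretch
where the cdf is flat. -/
lemma Iic_ae_eq_cdf_le [NullSingletonClass μ] (t : ℝ) :
    (Set.Iic t : Set ℝ) =ᵐ[μ] cdf μ ⁻¹' Set.Iic (cdf μ t) := by
  have hm : Measurable (cdf μ) := (monotone_cdf μ).measurable
  refine ae_eq_of_subset_of_measure_ge (fun s hs => monotone_cdf μ hs) ?_
    measurableSet_Iic.nullMeasurableSet (measure_ne_top _ _)
  rw [← Measure.map_apply hm measurableSet_Iic, map_cdf, uniform01_Iic (cdf_le_one μ t), ofReal_cdf]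

lemma setLIntegral_Iic_cdf [NullSingletonClass μ] (t : ℝ) {φ : ℝ → ℝ≥0∞} (hφ : Measurable φ) :
    ∫⁻ s in Set.Iic t, φ (cdf μ s) ∂μ = ∫⁻ u in Set.Icc 0 (cdf μ t), φ u := by
  have hm : Measurable (cdf μ) := (monotone_cdf μ).measurable
  rw [setLIntegral_congr (Iic_ae_eq_cdf_le t),
    ← setLIntegral_map measurableSet_Iic hφ hm, map_cdf, uniform01,
    Measure.restrict_restrict measurableSet_Iic]
  congr 2
  have := cdf_le_one μ t
  ext u; simp only [Set.mem_inter_iff, Set.mem_Iic, Set.mem_Icc]; grind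

lemma integral_cdf [NullSingletonClass μ] {φ : ℝ → ℝ} (hφ : Continuous φ) :
    ∫ s, φ (cdf μ s) ∂μ = ∫ u in (0 : ℝ)..1, φ u := by
  have hm : Measurable (cdf μ) := (monotone_cdf μ).measurable
  rw [← integral_map hm.aemeasurable hφ.aestronglyMeasurable, map_cdf, uniform01,
    intervalIntegral.integral_of_le zero_le_one, integral_Icc_eq_integral_Ioc]

lemma setIntegral_Ioi_cdf [NullSingletonClass μ] (t : ℝ) {φ : ℝ → ℝ} (hφ : Continuous φ) :
    ∫ s in Set.Ioi t, φ (cdf μ s) ∂μ = ∫ u in (cdf μ t)..1, φ u := by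
  have hm : Measurable (cdf μ) := (monotone_cdf μ).measurable
  have he : (Set.Ioi t : Set ℝ) =ᵐ[μ] cdf μ ⁻¹' Set.Ioi (cdf μ t) := by
    have := (Iic_ae_eq_cdf_le (μ := μ) t).compl
    rwa [← Set.preimage_compl, Set.compl_Iic, Set.compl_Iic] at this
  rw [setIntegral_congr_set he, ← setIntegral_map measurableSet_Ioi
    hφ.aestronglyMeasurable hm.aemeasurable, map_cdf, uniform01,
    Measure.restrict_restrict measurableSet_Ioi,
    intervalIntegral.integral_of_le (cdf_le_one μ t)]
  congr 2
  have := cdf_nonneg μ t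
  ext u; simp only [Set.mem_inter_iff, Set.mem_Ioi, Set.mem_Icc, Set.mem_Ioc]; grind

end Cdf

/-! ### The law of the maximum of `k` draws. -/

section MaxLaw

variable {D : Measure ℝ} [IsProbabilityMeasure D] {k : ℕ}

lemma measurable_ciSup_fin {α : Type*} [MeasurableSpace α] {f : Fin k → α → ℝ}
    (hf : ∀ j, Measurable (f j)) : Measurable fun a => ⨆ j, f j a :=
  Measurable.iSup hf

instance : IsProbabilityMeasure (maxLaw D k) :=
  Measure.isProbabilityMeasure_map
    (measurable_ciSup_fin fun j => measurable_pi_apply j).aemeasurable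

lemma ciSup_fin_le_iff (hk : 1 ≤ k) {v : Fin k → ℝ} {t : ℝ} : ⨆ j, v j ≤ t ↔ ∀ j, v j ≤ t := by
  have : Nonempty (Fin k) := ⟨⟨0, hk⟩⟩
  exact ciSup_le_iff (Set.finite_range v).bddAbove

lemma maxLaw_Iic (hk : 1 ≤ k) (t : ℝ) : maxLaw D k (Set.Iic t) = D (Set.Iic t) ^ k := by
  rw [maxLaw, Measure.map_apply (measurable_ciSup_fin fun j => measurable_pi_apply j)
    measurableSet_Iic]
  have : (fun v : Fin k → ℝ => ⨆ j, v j) ⁻¹' Set.Iic t = Set.pi Set.univ fun _ => Set.Iic t := by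
    ext v; simp [ciSup_fin_le_iff hk, Pi.le_def]
  rw [this, Measure.pi_pi]
  simp

/-- On a half-line both sides are `F^k`, because `∫ k u^(k-1) du` over `[0, F(t)]` is `F(t)^k`. -/
lemma maxLaw_eq_withDensity [NullSingletonClass D] (hk : 1 ≤ k) :
    maxLaw D k = D.withDensity fun s => ENNReal.ofReal (k * cdf D s ^ (k - 1)) := by
  refine Measure.ext_of_Iic _ _ fun t => ?_
  rw [maxLaw_Iic hk, withDensity_apply _ measurableSet_Iic,
    setLIntegral_Iic_cdf (φ := fun u => ENNReal.ofReal (k * u ^ (k - 1))) t (by fun_prop),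
    ← ofReal_integral_eq_lintegral_ofReal, integral_Icc_eq_integral_Ioc,
    ← intervalIntegral.integral_of_le (cdf_nonneg D t), intervalIntegral.integral_const_mul,
    integral_pow, ← ofReal_cdf, ← ENNReal.ofReal_pow (cdf_nonneg D t)]
  · congr 1
    obtain ⟨m, rfl⟩ := Nat.exists_eq_add_of_le' hk
    simp only [Nat.add_sub_cancel]
    push_cast
    field_simp
    simp
  · exact (by fun_prop : Continuous fun u : ℝ => (k : ℝ) * u ^ (k - 1)).continuousOn.integrableOn_Icc
  · filter_upwards [ae_restrict_mem measurableSet_Icc] with u hu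
    exact mul_nonneg (Nat.cast_nonneg _) (pow_nonneg hu.1 _)

lemma HasNondecreasingDensity.noAtoms {D : Measure ℝ} (h : HasNondecreasingDensity D) :
    NullSingletonClass D := by
  obtain ⟨f, I, hf, -, -, -, rfl⟩ := h
  exact ⟨fun t => withDensity_absolutelyContinuous _ _ (measure_singleton t)⟩

/-- The new density `f · k F^(k-1)` is a product of nonnegative functions that are nondecreasing on
`I`. -/
lemma HasNondecreasingDensity.maxLaw (h : HasNondecreasingDensity D) (hk : 1 ≤ k) :
    HasNondecreasingDensity (maxLaw D k) := by
  have := h.noAtoms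
  obtain ⟨f, I, hf, hI, hmono, hzero, hD⟩ := h
  have hm : Measurable (cdf D) := (monotone_cdf D).measurable
  have hg : Measurable fun s => ENNReal.ofReal (k * cdf D s ^ (k - 1)) := by fun_prop
  refine ⟨fun s => f s * ENNReal.ofReal (k * cdf D s ^ (k - 1)), I, hf.mul hg, hI, ?_, ?_, ?_⟩
  · intro s hs t ht hst
    have := cdf_nonneg D s
    have := monotone_cdf D hst
    exact mul_le_mul' (hmono hs ht hst) (ENNReal.ofReal_le_ofReal (by gcongr))
  · intro t ht
    simp only [hzero t ht, zero_mul]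
  · rw [maxLaw_eq_withDensity hk]
    have key : ∀ g : ℝ → ℝ≥0∞, Measurable g → D.withDensity g = volume.withDensity (f * g) :=
      fun g hg => by rw [hD]; exact (withDensity_mul volume hf hg).symm
    exact key _ hg

end MaxLaw

/-! ### Support and finiteness of nondecreasing densities. -/

section Density

variable {f : ℝ → ℝ≥0∞} {I : Set ℝ}

lemma exists_density_ne_zero {A : Set ℝ} (hA : MeasurableSet A)
    (h : volume.withDensity f A ≠ 0) : ∃ t ∈ A, f t ≠ 0 := by
  by_contra! hall
  rw [withDensity_apply _ hA] at h
  exact h (setLIntegral_eq_zero hA hall)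

lemma measure_Ioi_eq_zero_of_notMem {t₀ t : ℝ} (hI : I.OrdConnected) (hzero : ∀ t ∉ I, f t = 0)
    (ht₀ : t₀ ∈ I) (h : t₀ ≤ t) (ht : t ∉ I) : volume.withDensity f (Set.Ioi t) = 0 := by
  by_contra hne
  obtain ⟨s, hs, hfs⟩ := exists_density_ne_zero measurableSet_Ioi hne
  have hsI : s ∈ I := by_contra fun h => hfs (hzero s h)
  exact ht (hI.out ht₀ hsI ⟨h, le_of_lt hs⟩)

variable [IsProbabilityMeasure (volume.withDensity f)]

/-- Without an upper bound on the support, monotonicity would keep the density above a positive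
constant on a whole ray, giving infinite mass. -/
lemma exists_measure_Ioi_eq_zero (hI : I.OrdConnected) (hmono : MonotoneOn f I)
    (hzero : ∀ t ∉ I, f t = 0) : ∃ b : ℝ, 0 < b ∧ volume.withDensity f (Set.Ioi b) = 0 := by
  by_contra! hall
  obtain ⟨s, -, hs⟩ := exists_density_ne_zero (f := f) MeasurableSet.univ (by simp)
  have hsI : s ∈ I := by_contra fun h => hs (hzero s h)
  have hmem : ∀ t, s ≤ t → t ∈ I := by
    intro t hst
    obtain ⟨r, hr, hfr⟩ := exists_density_ne_zero measurableSet_Ioi (hall (max t 1) (by simp))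
    exact hI.out hsI (by_contra fun h => hfr (hzero r h)) ⟨hst, (le_max_left t 1).trans (le_of_lt hr)⟩
  have h1 : volume.withDensity f (Set.Ioi s) = ∞ := by
    rw [withDensity_apply _ measurableSet_Ioi, eq_top_iff]
    calc (∞ : ℝ≥0∞) = ∫⁻ _ in Set.Ioi s, f s := by
          rw [setLIntegral_const, Real.volume_Ioi, ENNReal.mul_top hs]
      _ ≤ _ := setLIntegral_mono' measurableSet_Ioi fun t ht =>
          hmono hsI (hmem t (le_of_lt ht)) (le_of_lt ht)
  exact measure_ne_top _ _ h1

/-- Mass on the left forces a positive density at `t₀`; an infinite value there would persist up to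
a point `r` on the right and give infinite mass. -/
lemma density_mem_Ioo {t₀ : ℝ} (hI : I.OrdConnected) (hmono : MonotoneOn f I)
    (hzero : ∀ t ∉ I, f t = 0) (h0 : volume.withDensity f (Set.Iic t₀) ≠ 0)
    (h1 : volume.withDensity f (Set.Ioi t₀) ≠ 0) : t₀ ∈ I ∧ f t₀ ≠ 0 ∧ f t₀ ≠ ∞ := by
  obtain ⟨s, hs, hfs⟩ := exists_density_ne_zero measurableSet_Iic h0
  obtain ⟨r, hr, hfr⟩ := exists_density_ne_zero measurableSet_Ioi h1
  have hsI : s ∈ I := by_contra fun h => hfs (hzero s h)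
  have hrI : r ∈ I := by_contra fun h => hfr (hzero r h)
  have htI : t₀ ∈ I := hI.out hsI hrI ⟨hs, le_of_lt hr⟩
  refine ⟨htI, fun h => hfs (le_antisymm (h ▸ hmono hsI htI hs) zero_le), fun h => ?_⟩
  have h2 : volume.withDensity f (Set.Ioc t₀ r) = ∞ := by
    rw [withDensity_apply _ measurableSet_Ioc, eq_top_iff]
    calc (∞ : ℝ≥0∞) = ∫⁻ _ in Set.Ioc t₀ r, f t₀ := by
          rw [setLIntegral_const, Real.volume_Ioc, h, ENNReal.top_mul]
          simpa using hr
      _ ≤ _ := setLIntegral_mono' measurableSet_Ioc fun t ht =>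
          hmono htI (hI.out htI hrI ⟨ht.1.le, ht.2⟩) ht.1.le
  exact measure_ne_top _ _ h2

end Density

/-! ### Single-crossing comparison under a nondecreasing density. -/

section SingleCrossing

variable {μ : Measure ℝ} [IsProbabilityMeasure μ]

lemma HasNondecreasingDensity.exists_Ioi_null (hμ : HasNondecreasingDensity μ) :
    ∃ b : ℝ, 0 < b ∧ μ (Set.Ioi b) = 0 := by
  obtain ⟨f, I, hf, hI, hmono, hzero, rfl⟩ := hμ
  exact exists_measure_Ioi_eq_zero hI hmono hzero

/-- Under a nondecreasing density, the cdf spends little time where a function that crosses `0`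
once, from below, and has mean `0` is positive. -/
lemma integral_comp_cdf_nonpos (hμ : HasNondecreasingDensity μ) {a b : ℝ}
    (hab : a ≤ b) (ha : μ (Set.Iic a) = 0) (hb : μ (Set.Ioi b) = 0) {h : ℝ → ℝ} (hh : Continuous h)
    (hint : ∫ u in (0 : ℝ)..1, h u = 0) (h1 : h 1 = 0) {c : ℝ} (hc0 : 0 < c) (hc1 : c < 1)
    (hneg : ∀ u, 0 ≤ u → u ≤ c → h u ≤ 0) (hpos : ∀ u, c ≤ u → u ≤ 1 → 0 ≤ h u) :
    ∫ t in a..b, h (cdf μ t) ≤ 0 := by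
  have := hμ.noAtoms
  obtain ⟨t₀, ht₀⟩ := exists_cdf_eq (μ := μ) hc0 hc1
  have hcont : Continuous fun t => h (cdf μ t) := hh.comp continuous_cdf
  obtain ⟨f, I, hf, hI, hmono, hzero, hD⟩ := hμ
  have : IsProbabilityMeasure (volume.withDensity f) := hD ▸ inferInstance
  have hone : ∀ t, μ (Set.Ioi t) = 0 → cdf μ t = 1 := by
    intro t ht
    rw [cdf_eq_real, ← Set.compl_Ioi, probReal_compl_eq_one_sub measurableSet_Ioi]
    simp [Measure.real, ht]
  obtain ⟨htI, hf0, hftop⟩ : t₀ ∈ I ∧ f t₀ ≠ 0 ∧ f t₀ ≠ ∞ := by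
    refine density_mem_Ioo hI hmono hzero ?_ ?_
    · rw [← hD, ← ofReal_cdf, ht₀]; simpa using hc0
    · rw [← hD]; intro h; exact hc1.ne (ht₀ ▸ hone t₀ h)
  have hr : 0 < (f t₀).toReal := ENNReal.toReal_pos hf0 hftop
  have hlint : ∫⁻ t, f t ≠ ∞ := by
    rw [← setLIntegral_univ, ← withDensity_apply _ MeasurableSet.univ]; exact measure_ne_top _ _
  have hfin : ∀ᵐ t, f t < ∞ := ae_lt_top hf hlint
  have hfint : Integrable fun t => (f t).toReal :=
    integrable_toReal_of_lintegral_ne_top hf.aemeasurable hlint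
  have hsupp : ∀ᵐ t ∂μ, t ∈ Set.Icc a b := by
    rw [ae_iff]
    refine measure_mono_null (t := Set.Iic a ∪ Set.Ioi b) ?_ (measure_union_null ha hb)
    intro t ht
    by_contra hn
    simp only [Set.mem_union, Set.mem_Iic, Set.mem_Ioi, not_or, not_le, not_lt] at hn
    exact ht ⟨hn.1.le, hn.2⟩
  have hzeroint : ∫ t in Set.Icc a b, (f t).toReal * h (cdf μ t) = 0 := by
    have := setIntegral_withDensity_eq_setIntegral_toReal_smul hf (ae_restrict_of_ae hfin)
      (fun t => h (cdf μ t)) (measurableSet_Icc (a := a) (b := b))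
    simp only [smul_eq_mul] at this
    rw [← this]
    change ∫ t in Set.Icc a b, h (cdf μ t) ∂(volume.withDensity f) = 0
    rw [← hD, setIntegral_eq_integral_of_ae_compl_eq_zero, integral_cdf hh, hint]
    filter_upwards [hsupp] with t ht hn using absurd ht hn
  -- `f - f t₀` and `h (cdf μ t)` have the same sign on either side of `t₀`. To the right of `I` the
  -- density drops to `0`, but there the cdf is `1` and `h 1 = 0`.
  have hle : ∫ t in Set.Icc a b, (f t₀).toReal * h (cdf μ t) ≤
      ∫ t in Set.Icc a b, (f t).toReal * h (cdf μ t) := by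
    refine setIntegral_mono_on_ae (hcont.continuousOn.integrableOn_Icc.const_mul _)
      (hfint.integrableOn.mul_continuousOn hcont.continuousOn isCompact_Icc) measurableSet_Icc ?_
    filter_upwards [hfin] with t htop _
    rcases le_total t t₀ with htt | htt
    · have hnp : h (cdf μ t) ≤ 0 := hneg _ (cdf_nonneg μ t) (ht₀ ▸ monotone_cdf μ htt)
      refine mul_le_mul_of_nonpos_right (ENNReal.toReal_mono hftop ?_) hnp
      by_cases ht : t ∈ I
      · exact hmono ht htI htt
      · rw [hzero t ht]; exact zero_le
    · have hnn : 0 ≤ h (cdf μ t) := hpos _ (ht₀ ▸ monotone_cdf μ htt) (cdf_le_one μ t)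
      by_cases ht : t ∈ I
      · exact mul_le_mul_of_nonneg_right (ENNReal.toReal_mono htop.ne (hmono htI ht htt)) hnn
      · rw [hone t (hD ▸ measure_Ioi_eq_zero_of_notMem hI hzero htI htt ht), h1]; simp
  rw [hzeroint, integral_const_mul] at hle
  rw [intervalIntegral.integral_of_le hab, ← integral_Icc_eq_integral_Ioc]
  by_contra! hcon
  exact absurd hle (mul_pos hr hcon).not_ge

end SingleCrossing

/-! ### Gini's mean difference and the standard deviation. -/

section Gini

variable {μ : Measure ℝ} [IsProbabilityMeasure μ]

/-- Fubini for `cdf μ s - 1/2` on `t < s`: integrating over `t` gives the factor `s`, integrating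
over `s` gives `∫ (u - 1/2) du` from `cdf μ t` to `1`. -/
lemma integral_cdf_mul_one_sub [NullSingletonClass μ] {b : ℝ} (hb : 0 ≤ b)
    (hs : ∀ᵐ s ∂μ, s ∈ Set.Icc 0 b) :
    ∫ t in (0 : ℝ)..b, cdf μ t * (1 - cdf μ t) = 2 * ∫ s, s * (cdf μ s - 1 / 2) ∂μ := by
  have hm : Measurable (cdf μ) := (monotone_cdf μ).measurable
  set F : ℝ → ℝ → ℝ := fun s t => (Set.Ioi t).indicator (fun s => cdf μ s - 1 / 2) s with hF
  have hFint : Integrable (Function.uncurry F) (μ.prod (volume.restrict (Set.Ioc 0 b))) := by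
    refine Integrable.of_bound (Measurable.aestronglyMeasurable ?_) 1 (ae_of_all _ ?_)
    · have : Function.uncurry F =
          {q : ℝ × ℝ | q.2 < q.1}.indicator fun q => cdf μ q.1 - 1 / 2 := by
        ext ⟨s, t⟩; simp [hF, Set.indicator]
      rw [this]
      exact ((hm.comp measurable_fst).sub_const _).indicator
        (measurableSet_lt measurable_snd measurable_fst)
    · rintro ⟨s, t⟩
      have := cdf_nonneg μ s
      have := cdf_le_one μ s
      simp only [hF, Function.uncurry_apply_pair, Set.indicator, Real.norm_eq_abs, abs_le]
      split_ifs <;> constructor <;> linarith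
  have hswap := integral_integral_swap hFint
  have hleft : ∀ᵐ s ∂μ, ∫ t in Set.Ioc 0 b, F s t = s * (cdf μ s - 1 / 2) := by
    filter_upwards [hs] with s hs
    have : F s = (Set.Iio s).indicator fun _ => cdf μ s - 1 / 2 := by
      ext t; simp [hF, Set.indicator]
    rw [this, setIntegral_indicator measurableSet_Iio, setIntegral_const, smul_eq_mul]
    congr 1
    have h2 : Set.Ioc 0 b ∩ Set.Iio s = Set.Ioo 0 s := by
      ext t; simp only [Set.mem_inter_iff, Set.mem_Ioc, Set.mem_Iio, Set.mem_Ioo]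
      have := hs.2; grind
    rw [h2, Real.volume_real_Ioo_of_le hs.1, sub_zero]
  have hright : ∀ t, ∫ s, F s t ∂μ = cdf μ t * (1 - cdf μ t) / 2 := by
    intro t
    rw [hF, integral_indicator measurableSet_Ioi,
      setIntegral_Ioi_cdf t (φ := fun u => u - 1 / 2) (by fun_prop),
      intervalIntegral.integral_sub (by simp) (by simp)]
    simp only [integral_id, intervalIntegral.integral_const, smul_eq_mul]
    ring
  rw [integral_congr_ae hleft] at hswap
  simp only [hright] at hswap
  rw [hswap, intervalIntegral.integral_of_le hb, integral_div]
  ring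

lemma integral_cdf_sub_half_sq [NullSingletonClass μ] :
    ∫ s, (cdf μ s - 1 / 2) ^ 2 ∂μ = 1 / 12 := by
  rw [integral_cdf (φ := fun u => (u - 1 / 2) ^ 2) (by fun_prop)]
  rw [intervalIntegral.integral_comp_sub_right (fun u => u ^ 2), integral_pow]
  norm_num

lemma integral_cdf_sub_half [NullSingletonClass μ] : ∫ s, (cdf μ s - 1 / 2) ∂μ = 0 := by
  rw [integral_cdf (φ := fun u => u - 1 / 2) (by fun_prop),
    intervalIntegral.integral_sub (by simp) (by simp)]
  simp

/-- Cauchy–Schwarz for the covariance of `s` and `cdf μ s`, the latter having variance `1/12`. -/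
lemma integral_mul_cdf_sub_half_sq_le [NullSingletonClass μ] {b : ℝ}
    (hs : ∀ᵐ s ∂μ, s ∈ Set.Icc 0 b) :
    12 * (∫ s, s * (cdf μ s - 1 / 2) ∂μ) ^ 2 ≤ Var[id; μ] := by
  have hm : Measurable (cdf μ) := (monotone_cdf μ).measurable
  rw [variance_eq_integral aemeasurable_id]
  simp only [id]
  set m := ∫ s, s ∂μ
  set C := ∫ s, s * (cdf μ s - 1 / 2) ∂μ with hC
  have hid : Integrable (fun s : ℝ => s) μ := by
    refine Integrable.of_bound (by fun_prop) b ?_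
    filter_upwards [hs] with s hs
    rw [Real.norm_eq_abs, abs_of_nonneg hs.1]; exact hs.2
  have hbd : ∀ s, ‖cdf μ s - 1 / 2‖ ≤ 1 := fun s => by
    have := cdf_nonneg μ s
    have := cdf_le_one μ s
    rw [Real.norm_eq_abs, abs_le]; constructor <;> linarith
  have hG : Integrable (fun s => cdf μ s - 1 / 2) μ :=
    Integrable.of_bound (by fun_prop) 1 (ae_of_all _ hbd)
  have hG2 : Integrable (fun s => (cdf μ s - 1 / 2) ^ 2) μ := by
    simp only [sq]; exact hG.bdd_mul (by fun_prop) (ae_of_all _ hbd)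
  have hc : Integrable (fun s : ℝ => s - m) μ := hid.sub (integrable_const m)
  have hc2 : Integrable (fun s : ℝ => (s - m) ^ 2) μ := by
    simp only [sq]
    refine hc.bdd_mul (by fun_prop) (c := b + |m|) ?_
    filter_upwards [hs] with s hs
    rw [Real.norm_eq_abs]
    refine (abs_sub _ _).trans ?_
    rw [abs_of_nonneg hs.1]; linarith [hs.2]
  have hsG : Integrable (fun s : ℝ => s * (cdf μ s - 1 / 2)) μ := by
    refine hG.bdd_mul (by fun_prop) (c := b) ?_
    filter_upwards [hs] with s hs
    rw [Real.norm_eq_abs, abs_of_nonneg hs.1]; exact hs.2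
  -- `12 * C` is the regression coefficient: covariance `C` over variance `1/12`.
  have hnn : 0 ≤ ∫ s, ((s - m) - 12 * C * (cdf μ s - 1 / 2)) ^ 2 ∂μ :=
    integral_nonneg fun s => sq_nonneg _
  have hexp : ∀ s, ((s - m) - 12 * C * (cdf μ s - 1 / 2)) ^ 2 =
      (s - m) ^ 2 - (24 * C) * (s * (cdf μ s - 1 / 2)) + (24 * C * m) * (cdf μ s - 1 / 2)
        + (144 * C ^ 2) * (cdf μ s - 1 / 2) ^ 2 := fun s => by ring
  simp only [hexp] at hnn
  have i1 : Integrable (fun s => (s - m) ^ 2 - (24 * C) * (s * (cdf μ s - 1 / 2))) μ :=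
    hc2.sub (hsG.const_mul _)
  have i2 : Integrable (fun s => (s - m) ^ 2 - (24 * C) * (s * (cdf μ s - 1 / 2))
      + (24 * C * m) * (cdf μ s - 1 / 2)) μ := i1.add (hG.const_mul _)
  rw [integral_add i2 (hG2.const_mul _), integral_add i1 (hG.const_mul _),
    integral_sub hc2 (hsG.const_mul _), integral_const_mul, integral_const_mul, integral_const_mul,
    integral_cdf_sub_half_sq, integral_cdf_sub_half, ← hC] at hnn
  linarith

end Gini

/-! ### The expected gap between the top two draws. -/

lemma exists_pow_eq {m : ℕ} (hm : m ≠ 0) {r : ℝ} (h0 : 0 < r) (h1 : r < 1) :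
    ∃ c : ℝ, 0 < c ∧ c < 1 ∧ c ^ m = r := by
  obtain ⟨c, hc, hcr⟩ := intermediate_value_Icc (zero_le_one (α := ℝ))
    (f := fun c => c ^ m) (by fun_prop) (show r ∈ _ by simp [hm, h0.le, h1.le])
  refine ⟨c, lt_of_le_of_ne hc.1 ?_, lt_of_le_of_ne hc.2 ?_, hcr⟩
  · rintro rfl; simp [hm] at hcr; exact h0.ne hcr
  · rintro rfl; simp at hcr; exact h1.ne hcr.symm

/-- The expected gap between the largest and the second largest of `m + 2` draws from a law with a
nondecreasing density. -/
lemma integral_gap_le {μ : Measure ℝ} [IsProbabilityMeasure μ] (hμ : HasNondecreasingDensity μ)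
    (h0 : μ (Set.Iic 0) = 0) {b : ℝ} (hb0 : 0 ≤ b) (hb : μ (Set.Ioi b) = 0) (m : ℕ) :
    ∫ t in (0 : ℝ)..b, ((m : ℝ) + 2) * ((1 - cdf μ t) * cdf μ t ^ (m + 1)) ≤
      √(12 * Var[id; μ]) / (m + 3) := by
  have := hμ.noAtoms
  have hG : Continuous (cdf μ) := continuous_cdf
  have hs : ∀ᵐ s ∂μ, s ∈ Set.Icc 0 b := by
    rw [ae_iff]
    refine measure_mono_null (t := Set.Iic 0 ∪ Set.Ioi b) ?_ (measure_union_null h0 hb)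
    intro t ht
    by_contra hn
    simp only [Set.mem_union, Set.mem_Iic, Set.mem_Ioi, not_or, not_le, not_lt] at hn
    exact ht ⟨hn.1.le, hn.2⟩
  have hm0 : (0 : ℝ) ≤ m := Nat.cast_nonneg m
  -- The difference used below factors as `(m + 2) u (1 - u) (u^m - r)`, so it crosses zero where
  -- `u^m = r`. For `m = 0` one has `r = 1`, the difference vanishes identically and any crossing
  -- point serves.
  set r : ℝ := 6 / (((m : ℝ) + 2) * (m + 3)) with hr
  have hrm : 6 / ((m : ℝ) + 3) = (m + 2) * r := by rw [hr]; field_simp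
  obtain ⟨c, hc0, hc1, hcr⟩ : ∃ c : ℝ, 0 < c ∧ c < 1 ∧ c ^ m = r := by
    rcases eq_or_ne m 0 with rfl | hm
    · exact ⟨1 / 2, by norm_num, by norm_num, by rw [hr]; norm_num⟩
    · refine exists_pow_eq hm (by positivity) ?_
      have : (1 : ℝ) ≤ m := by exact_mod_cast Nat.one_le_iff_ne_zero.2 hm
      rw [hr, div_lt_one (by positivity)]; nlinarith
  have hcross := integral_comp_cdf_nonpos hμ hb0 h0 hb
    (h := fun u => ((m : ℝ) + 2) * (u ^ (m + 1) - u ^ (m + 2)) - 6 / ((m : ℝ) + 3) * (u - u ^ 2))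
    (by fun_prop) ?_ (by simp) hc0 hc1 ?_ ?_
  · rw [intervalIntegral.integral_sub (Continuous.intervalIntegrable (by fun_prop) _ _)
      (Continuous.intervalIntegrable (by fun_prop) _ _), sub_nonpos,
      intervalIntegral.integral_const_mul (6 / ((m : ℝ) + 3))] at hcross
    have e1 : ∫ t in (0 : ℝ)..b, (cdf μ t - cdf μ t ^ 2) =
        2 * ∫ s, s * (cdf μ s - 1 / 2) ∂μ := by
      rw [← integral_cdf_mul_one_sub hb0 hs]
      congr 1; ext t; ring
    have e2 : ∀ t, ((m : ℝ) + 2) * ((1 - cdf μ t) * cdf μ t ^ (m + 1)) =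
        ((m : ℝ) + 2) * (cdf μ t ^ (m + 1) - cdf μ t ^ (m + 2)) := fun t => by ring
    simp only [e2]
    refine hcross.trans ?_
    rw [e1, div_mul_eq_mul_div]
    gcongr
    refine (le_abs_self _).trans (Real.abs_le_sqrt ?_)
    have := integral_mul_cdf_sub_half_sq_le hs
    linarith
  · rw [intervalIntegral.integral_sub (Continuous.intervalIntegrable (by fun_prop) _ _)
      (Continuous.intervalIntegrable (by fun_prop) _ _), intervalIntegral.integral_const_mul,
      intervalIntegral.integral_const_mul,
      intervalIntegral.integral_sub (by simp) (by simp),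
      intervalIntegral.integral_sub (by simp) (by simp), integral_pow, integral_pow, integral_pow,
      integral_id]
    push_cast
    simp
    field_simp
    ring
  · intro u hu0 huc
    have h1 : u ^ m ≤ r := hcr ▸ pow_le_pow_left₀ hu0 huc m
    have h2 : 0 ≤ ((m : ℝ) + 2) * (u * (1 - u)) :=
      mul_nonneg (by positivity) (mul_nonneg hu0 (by linarith))
    rw [hrm]
    have := mul_le_mul_of_nonneg_left h1 h2
    ring_nf at this ⊢
    linarith
  · intro u huc hu1
    have h1 : r ≤ u ^ m := hcr ▸ pow_le_pow_left₀ hc0.le huc m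
    have h2 : 0 ≤ ((m : ℝ) + 2) * (u * (1 - u)) :=
      mul_nonneg (by positivity) (mul_nonneg (by linarith) (by linarith))
    rw [hrm]
    have := mul_le_mul_of_nonneg_left h1 h2
    ring_nf at this ⊢
    linarith

/-! ### From the equilibrium bound to the expected loss. -/

section Gap

variable {n k : ℕ} {Ω : Type*} {x : Ω → ℝ}

/-- The value of the best solution of agent `i`. -/
def agentMax (x : Ω → ℝ) (w : Solutions n k Ω) (i : Fin n) : ℝ := ⨆ c, x (w i c)

/-- Realization and threshold such that agent `i` alone has solutions above the threshold. -/
def soleAbove (n k : ℕ) (x : Ω → ℝ) (i : Fin n) : Set (Solutions n k Ω × ℝ) :=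
  {q | q.2 < agentMax x q.1 i ∧ ∀ j ≠ i, agentMax x q.1 j ≤ q.2}

/-- The measure of the thresholds that only one agent exceeds: the gap between the best and the
second best agent. -/
def gap (x : Ω → ℝ) (w : Solutions n k Ω) : ℝ≥0∞ :=
  ∑ i : Fin n, volume.restrict (Set.Ici (0 : ℝ)) (Prod.mk w ⁻¹' soleAbove n k x i)

/-- In equilibrium the principal loses at most the gap between the best two agents. -/
lemma iSup_le_add_gap {M : MSPM n Ω} (hM : ∀ i, M.eligible i = Set.univ) (hxpos : ∀ v, 0 < x v)
    {y : Fin n → Ω → ℝ} (hy : ∀ i v, 0 < y i v) (hn : 2 ≤ n) (hk : 1 ≤ k) {w : Solutions n k Ω}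
    (htie : ∀ i j, i ≠ j → ∀ c d, x (w i c) ≠ x (w j d)) {p : Mixed n k}
    (hp : M.IsNash x y w p) :
    ENNReal.ofReal (⨆ i, ⨆ c, x (w i c)) ≤
      ENNReal.ofReal (expect p fun a => M.principalUtility x (proposal w a)) + gap x w := by
  have : Nonempty (Fin n) := ⟨⟨0, by omega⟩⟩
  have : Nonempty (Fin k) := ⟨⟨0, hk⟩⟩
  set U := expect p fun a => M.principalUtility x (proposal w a)
  have hU0 : 0 ≤ U := le_expect hp.1 fun a _ => MSPM.principalUtility_nonneg hxpos _
  obtain ⟨i, hi⟩ := exists_eq_ciSup_of_finite (f := fun i => ⨆ c, x (w i c))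
  have hbest : ∀ j, ∃ c, x (w j c) = agentMax x w j := fun j =>
    exists_eq_ciSup_of_finite (f := fun c => x (w j c))
  change agentMax x w i = _ at hi
  rw [← hi]
  -- A second agent above a threshold `t ≥ U` would force the equilibrium payoff above `t`.
  have hsub : Set.Ico U (agentMax x w i) ⊆
      Prod.mk w ⁻¹' soleAbove n k x i ∩ Set.Ici (0 : ℝ) := by
    intro t ht
    refine ⟨⟨ht.2, fun j hj => ?_⟩, hU0.trans ht.1⟩
    by_contra! hlt
    obtain ⟨c, hc⟩ := hbest i
    obtain ⟨d, hd⟩ := hbest j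
    have := le_expect_principalUtility hM hxpos hy htie hp hj.symm (c := c) (d := d)
      (m := min (agentMax x w i) (agentMax x w j)) (hc ▸ min_le_left _ _) (hd ▸ min_le_right _ _)
    exact absurd (this.trans ht.1) (lt_min ht.2 hlt).not_ge
  calc ENNReal.ofReal (agentMax x w i)
      ≤ ENNReal.ofReal U + ENNReal.ofReal (agentMax x w i - U) := by
        have h := ENNReal.ofReal_add_le (p := U) (q := agentMax x w i - U)
        rwa [add_sub_cancel] at h
    _ = ENNReal.ofReal U + volume (Set.Ico U (agentMax x w i)) := by rw [Real.volume_Ico]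
    _ ≤ ENNReal.ofReal U + volume.restrict (Set.Ici (0 : ℝ)) (Prod.mk w ⁻¹' soleAbove n k x i) := by
        refine add_le_add le_rfl ?_
        rw [Measure.restrict_apply' measurableSet_Ici]
        exact measure_mono hsub
    _ ≤ _ := by
        gcongr
        exact Finset.single_le_sum (f := fun i => volume.restrict (Set.Ici (0 : ℝ))
          (Prod.mk w ⁻¹' soleAbove n k x i)) (fun _ _ => zero_le) (Finset.mem_univ i)

variable [MeasurableSpace Ω]

lemma measurableSet_soleAbove (hx : Measurable x) (i : Fin n) :
    MeasurableSet (soleAbove n k x i) := by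
  have hM : ∀ j, Measurable fun q : Solutions n k Ω × ℝ => agentMax x q.1 j := fun j =>
    measurable_ciSup_fin fun c => by fun_prop
  have hset : soleAbove n k x i = {q | q.2 < agentMax x q.1 i} ∩
      ⋂ j, ⋂ (_ : j ≠ i), {q | agentMax x q.1 j ≤ q.2} := by
    ext q; simp [soleAbove]
  rw [hset]
  exact (measurableSet_lt measurable_snd (hM i)).inter <| MeasurableSet.iInter fun j =>
    MeasurableSet.iInter fun _ => measurableSet_le (hM j) measurable_snd

lemma pi_iSup_mem {P : Measure Ω} [IsProbabilityMeasure P] (hx : Measurable x) {S : Set ℝ}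
    (hS : MeasurableSet S) :
    Measure.pi (fun _ : Fin k => P) {v | ⨆ c, x (v c) ∈ S} = maxLaw (P.map x) k S := by
  have : IsProbabilityMeasure (P.map x) := Measure.isProbabilityMeasure_map hx.aemeasurable
  have h := Measure.pi_map_pi (μ := fun _ : Fin k => P) (f := fun _ => x)
    fun _ => hx.aemeasurable
  rw [maxLaw, Measure.map_apply (measurable_ciSup_fin fun j => measurable_pi_apply j) hS, ← h,
    Measure.map_apply (by fun_prop)
      ((measurable_ciSup_fin fun j => measurable_pi_apply j) hS)]
  rfl

instance (P : Measure Ω) [IsProbabilityMeasure P] : IsProbabilityMeasure (solutionsLaw n k P) := by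
  unfold solutionsLaw; infer_instance

lemma solutionsLaw_soleAbove {P : Measure Ω} [IsProbabilityMeasure P] (hx : Measurable x)
    (i : Fin n) (t : ℝ) :
    solutionsLaw n k P {w | (w, t) ∈ soleAbove n k x i} =
      maxLaw (P.map x) k (Set.Ioi t) * maxLaw (P.map x) k (Set.Iic t) ^ (n - 1) := by
  classical
  have hset : {w | (w, t) ∈ soleAbove n k x i} = Set.pi Set.univ fun j : Fin n =>
      {v : Fin k → Ω | ⨆ c, x (v c) ∈ if j = i then Set.Ioi t else Set.Iic t} := by
    ext w
    simp only [soleAbove, agentMax, Set.mem_ofPred_eq, Set.mem_pi, Set.mem_univ, true_imp_iff]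
    constructor
    · rintro ⟨h1, h2⟩ j
      split_ifs with h
      · subst h; exact h1
      · exact h2 j h
    · intro h
      refine ⟨by simpa using h i, fun j hj => by simpa [hj] using h j⟩
  rw [hset, solutionsLaw, Measure.pi_pi, ← Finset.mul_prod_erase _ _ (Finset.mem_univ i)]
  congr 1
  · rw [if_pos rfl, pi_iSup_mem hx measurableSet_Ioi]
  · rw [Finset.prod_congr rfl (g := fun _ => maxLaw (P.map x) k (Set.Iic t)) fun j hj => by
      rw [if_neg (Finset.ne_of_mem_erase hj), pi_iSup_mem hx measurableSet_Iic]]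
    simp

lemma measurable_gap (hx : Measurable x) : Measurable (gap (n := n) (k := k) x) :=
  Finset.measurable_sum _ fun i _ => measurable_measure_prodMk_left (measurableSet_soleAbove hx i)

/-- By Tonelli the thresholds are integrated last; symmetry makes the `n` summands equal. -/
lemma lintegral_gap {P : Measure Ω} [IsProbabilityMeasure P] (hx : Measurable x) :
    ∫⁻ w, gap x w ∂(solutionsLaw n k P) =
      n * ∫⁻ t in Set.Ici (0 : ℝ),
        maxLaw (P.map x) k (Set.Ioi t) * maxLaw (P.map x) k (Set.Iic t) ^ (n - 1) := by
  unfold gap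
  rw [lintegral_finsetSum _ fun i _ =>
    measurable_measure_prodMk_left (measurableSet_soleAbove hx i)]
  rw [Finset.sum_congr rfl (g := fun _ => ∫⁻ t in Set.Ici (0 : ℝ),
        maxLaw (P.map x) k (Set.Ioi t) * maxLaw (P.map x) k (Set.Iic t) ^ (n - 1)) fun i _ => by
      rw [← Measure.prod_apply (measurableSet_soleAbove hx i),
        Measure.prod_apply_symm (measurableSet_soleAbove hx i)]
      exact lintegral_congr fun t => solutionsLaw_soleAbove hx i t]
  simp

lemma lintegral_gap_le {P : Measure Ω} [IsProbabilityMeasure P] (hx : Measurable x)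
    (hxpos : ∀ v, 0 < x v) (hn : 2 ≤ n) (hk : 1 ≤ k) (hP : HasNondecreasingDensity (P.map x)) :
    ∫⁻ w, gap x w ∂(solutionsLaw n k P) ≤ ENNReal.ofReal (factor (P.map x) n k) := by
  have : IsProbabilityMeasure (P.map x) := Measure.isProbabilityMeasure_map hx.aemeasurable
  rw [lintegral_gap hx, factor]
  have hμ := hP.maxLaw hk
  have h0 : maxLaw (P.map x) k (Set.Iic 0) = 0 := by
    have : x ⁻¹' Set.Iic 0 = ∅ := by ext v; simpa using hxpos v
    rw [maxLaw_Iic hk, Measure.map_apply hx measurableSet_Iic, this, measure_empty,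
      zero_pow (by omega)]
  obtain ⟨b, hb0, hb⟩ := hμ.exists_Ioi_null
  -- Here `n = m + 2`, so the denominator `m + 3` of `integral_gap_le` is `n + 1`.
  obtain ⟨m, rfl⟩ := Nat.exists_eq_add_of_le' hn
  have key := integral_gap_le hμ h0 hb0.le hb m
  have := hμ.noAtoms
  have hprob : IsProbabilityMeasure (maxLaw (P.map x) k) := inferInstance
  generalize maxLaw (P.map x) k = μ at *
  have hG : Continuous (cdf μ) := continuous_cdf
  have hIoi : ∀ t, μ (Set.Ioi t) = ENNReal.ofReal (1 - cdf μ t) := by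
    intro t
    rw [ENNReal.ofReal_sub _ (cdf_nonneg μ t), ofReal_cdf, ← Set.compl_Iic,
      prob_compl_eq_one_sub measurableSet_Iic, ENNReal.ofReal_one]
  calc ((m + 2 : ℕ) : ℝ≥0∞) * ∫⁻ t in Set.Ici (0 : ℝ), μ (Set.Ioi t) * μ (Set.Iic t) ^ (m + 2 - 1)
      ≤ ((m + 2 : ℕ) : ℝ≥0∞) * ∫⁻ t in Set.Icc (0 : ℝ) b,
          μ (Set.Ioi t) * μ (Set.Iic t) ^ (m + 2 - 1) := by
        refine mul_le_mul' le_rfl ?_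
        calc _ ≤ ∫⁻ t in Set.Icc (0 : ℝ) b ∪ Set.Ioi b,
              μ (Set.Ioi t) * μ (Set.Iic t) ^ (m + 2 - 1) :=
              lintegral_mono_set fun t ht => (le_or_gt t b).imp (fun h => ⟨ht, h⟩) id
          _ ≤ _ := lintegral_union_le _ _ _
          _ = _ := by
            rw [setLIntegral_eq_zero measurableSet_Ioi, add_zero]
            intro t ht
            simp [measure_mono_null (Set.Ioi_subset_Ioi (le_of_lt ht)) hb]
    _ = ∫⁻ t in Set.Icc (0 : ℝ) b,
          ENNReal.ofReal (((m : ℝ) + 2) * ((1 - cdf μ t) * cdf μ t ^ (m + 1))) := by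
        rw [← lintegral_const_mul' _ _ (ENNReal.natCast_ne_top _)]
        refine lintegral_congr fun t => ?_
        have h1 := cdf_nonneg μ t
        have h2 := cdf_le_one μ t
        rw [ENNReal.ofReal_mul (by positivity), ENNReal.ofReal_mul (by linarith), hIoi,
          ENNReal.ofReal_pow h1, ofReal_cdf, ← ENNReal.ofReal_natCast]
        congr 2
        push_cast; ring
    _ = ENNReal.ofReal (∫ t in (0 : ℝ)..b,
          ((m : ℝ) + 2) * ((1 - cdf μ t) * cdf μ t ^ (m + 1))) := by
        rw [intervalIntegral.integral_of_le hb0.le, ← integral_Icc_eq_integral_Ioc,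
          ofReal_integral_eq_lintegral_ofReal]
        · exact Continuous.integrableOn_Icc (by fun_prop)
        · refine ae_of_all _ fun t => ?_
          have h1 := cdf_nonneg μ t
          have h2 := cdf_le_one μ t
          exact mul_nonneg (by positivity) (mul_nonneg (by linarith) (by positivity))
    _ ≤ _ := by
        refine ENNReal.ofReal_le_ofReal (key.trans_eq ?_)
        push_cast
        ring

/-- Different agents have different solutions almost surely. -/
lemma ae_no_tie {P : Measure Ω} [IsProbabilityMeasure P] (hx : Measurable x)
    [NullSingletonClass (P.map x)] :
    ∀ᵐ w ∂(solutionsLaw n k P), ∀ i j, i ≠ j → ∀ c d, x (w i c) ≠ x (w j d) := by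
  simp only [ae_all_iff]
  intro i j hij c d
  have hmeas : ∀ (i : Fin n) (c : Fin k), Measurable fun w : Solutions n k Ω => x (w i c) :=
    fun i c => by fun_prop
  have hind : IndepFun (fun w : Solutions n k Ω => x (w i c)) (fun w => x (w j d))
      (solutionsLaw n k P) :=
    ((iIndepFun_pi (μ := fun _ : Fin n => Measure.pi fun _ : Fin k => P)
      (X := fun _ v => v) fun _ => aemeasurable_id).indepFun hij).comp
      (φ := fun v : Fin k → Ω => x (v c)) (ψ := fun v : Fin k → Ω => x (v d))
      (by fun_prop) (by fun_prop)
  have hmarg : (solutionsLaw n k P).map (fun w => x (w j d)) = P.map x := by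
    have h1 : MeasurePreserving (fun w : Solutions n k Ω => w j) (solutionsLaw n k P)
      (Measure.pi fun _ : Fin k => P) :=
      measurePreserving_eval (fun _ : Fin n => Measure.pi fun _ : Fin k => P) j
    have h2 := (measurePreserving_eval (fun _ : Fin k => P) d).comp h1
    have h3 := Measure.map_map (μ := solutionsLaw n k P) hx h2.measurable
    rw [h2.map_eq] at h3
    exact h3.symm
  rw [indepFun_iff_map_prod_eq_prod_map_map (hmeas i c).aemeasurable (hmeas j d).aemeasurable,
    hmarg] at hind
  have hdiag : MeasurableSet {q : ℝ × ℝ | q.1 = q.2} :=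
    measurableSet_eq_fun measurable_fst measurable_snd
  have hz : (solutionsLaw n k P).map (fun w => (x (w i c), x (w j d))) {q | q.1 = q.2} = 0 := by
    have : IsProbabilityMeasure (P.map x) := Measure.isProbabilityMeasure_map hx.aemeasurable
    rw [hind, Measure.prod_apply hdiag, lintegral_eq_zero_iff (measurable_measure_prodMk_left hdiag)]
    refine ae_of_all _ fun a => ?_
    have : Prod.mk a ⁻¹' {q : ℝ × ℝ | q.1 = q.2} = {a} := by ext b; simp [eq_comm]
    change P.map x (Prod.mk a ⁻¹' _) = 0
    rw [this]
    exact measure_singleton a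
  rw [Measure.map_apply ((hmeas i c).prodMk (hmeas j d)) hdiag] at hz
  rw [ae_iff]
  simpa using hz

/-- The pointwise loss bound is integrated. The selection `σ` may be nonmeasurable: splitting the
lower integral of the sum only needs `gap` to be measurable. -/
theorem hasAdditivePoA_factor {M : MSPM n Ω} (hM : ∀ i, M.eligible i = Set.univ)
    (hx : Measurable x) (hxpos : ∀ v, 0 < x v) {y : Fin n → Ω → ℝ} (hy : ∀ i v, 0 < y i v)
    (hn : 2 ≤ n) (hk : 1 ≤ k) {P : Measure Ω} [IsProbabilityMeasure P]
    (hP : HasNondecreasingDensity (P.map x)) :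
    M.HasAdditivePoA x y k P (factor (P.map x) n k) := by
  intro σ hσ
  have := hP.noAtoms
  calc opt n k P x ≤ ∫⁻ w, (ENNReal.ofReal (expect (σ w) fun a =>
          M.principalUtility x (proposal w a)) + gap x w) ∂(solutionsLaw n k P) := by
        refine lintegral_mono_ae ?_
        filter_upwards [hσ, ae_no_tie (n := n) (k := k) hx] with w hw htie
        exact iSup_le_add_gap hM hxpos hy hn hk htie hw
    _ = (∫⁻ w, ENNReal.ofReal (expect (σ w) fun a => M.principalUtility x (proposal w a))
          ∂(solutionsLaw n k P)) + ∫⁻ w, gap x w ∂(solutionsLaw n k P) :=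
        lintegral_add_right _ (measurable_gap hx)
    _ ≤ _ := by gcongr; exact lintegral_gap_le hx hxpos hn hk hP

end Gap

/-! ### The uniform distribution. -/

section Uniform

lemma hasNondecreasingDensity_uniform01 : HasNondecreasingDensity uniform01 := by
  refine ⟨(Set.Icc 0 1).indicator 1, Set.Icc 0 1, measurable_one.indicator measurableSet_Icc,
    Set.ordConnected_Icc, ?_, fun t ht => Set.indicator_of_notMem ht _, ?_⟩
  · intro s hs t ht _
    rw [Set.indicator_of_mem hs, Set.indicator_of_mem ht]; rfl
  · rw [withDensity_indicator_one measurableSet_Icc, uniform01]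

lemma integral_maxLaw_uniform01 (m : ℕ) (φ : ℝ → ℝ) :
    ∫ u, φ u ∂(maxLaw uniform01 (m + 1)) = ∫ u in (0 : ℝ)..1, ((m : ℝ) + 1) * (u ^ m * φ u) := by
  have hm : Measurable (cdf uniform01) := (monotone_cdf _).measurable
  rw [maxLaw_eq_withDensity (by omega), integral_withDensity_eq_integral_toReal_smul (by fun_prop)
    (ae_of_all _ fun _ => ENNReal.ofReal_lt_top), uniform01,
    intervalIntegral.integral_of_le zero_le_one, ← integral_Icc_eq_integral_Ioc]
  refine setIntegral_congr_fun measurableSet_Icc fun u hu => ?_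
  have hc : cdf uniform01 u = u := by
    rw [cdf_eq_real, Measure.real, uniform01_Iic hu.2, ENNReal.toReal_ofReal hu.1]
  have := hu.1
  change (ENNReal.ofReal (((m + 1 : ℕ) : ℝ) * cdf uniform01 u ^ (m + 1 - 1))).toReal • φ u = _
  rw [hc, ENNReal.toReal_ofReal (by positivity), smul_eq_mul]
  push_cast
  ring

lemma variance_maxLaw_uniform01 {k : ℕ} (hk : 1 ≤ k) :
    Var[id; maxLaw uniform01 k] = (k : ℝ) / (((k : ℝ) + 1) ^ 2 * ((k : ℝ) + 2)) := by
  obtain ⟨m, rfl⟩ := Nat.exists_eq_add_of_le' hk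
  rw [variance_eq_integral aemeasurable_id]
  simp only [id, integral_maxLaw_uniform01]
  have h1 : ∫ u in (0 : ℝ)..1, ((m : ℝ) + 1) * (u ^ m * u) = ((m : ℝ) + 1) / (m + 2) := by
    have h : ∀ u : ℝ, ((m : ℝ) + 1) * (u ^ m * u) = ((m : ℝ) + 1) * u ^ (m + 1) := fun u => by ring
    simp only [h]
    rw [intervalIntegral.integral_const_mul, integral_pow]
    push_cast
    simp
    field_simp
    ring
  rw [h1]
  generalize ha : ((m : ℝ) + 1) / (m + 2) = a
  have h2 : ∀ u : ℝ, ((m : ℝ) + 1) * (u ^ m * (u - a) ^ 2) =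
      ((m : ℝ) + 1) * u ^ (m + 2) - ((m : ℝ) + 1) * (2 * a) * u ^ (m + 1)
        + ((m : ℝ) + 1) * a ^ 2 * u ^ m := fun u => by ring
  simp only [h2]
  rw [intervalIntegral.integral_add (Continuous.intervalIntegrable (by fun_prop) _ _)
      (Continuous.intervalIntegrable (by fun_prop) _ _),
    intervalIntegral.integral_sub (Continuous.intervalIntegrable (by fun_prop) _ _)
      (Continuous.intervalIntegrable (by fun_prop) _ _),
    intervalIntegral.integral_const_mul, intervalIntegral.integral_const_mul,
    intervalIntegral.integral_const_mul, integral_pow, integral_pow, integral_pow, ← ha]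
  push_cast
  simp only [one_pow, ne_eq, Nat.add_eq_zero_iff, OfNat.ofNat_ne_zero, one_ne_zero, and_false,
    not_false_eq_true, zero_pow, sub_zero]
  field_simp
  ring

lemma factor_uniform01 (n : ℕ) {k : ℕ} (hk : 1 ≤ k) :
    factor uniform01 n k =
      1 / ((n : ℝ) + 1) * √(12 * (k : ℝ) / (((k : ℝ) + 1) ^ 2 * ((k : ℝ) + 2))) := by
  rw [factor, variance_maxLaw_uniform01 hk, mul_div_assoc, one_div, div_eq_inv_mul]

/-- The last square root is at most `1` and tends to `1`, which yields both the upper bound and its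
asymptotic sharpness. -/
lemma factor_uniform01_eq (n : ℕ) {k : ℕ} (hk : 1 ≤ k) :
    factor uniform01 n k = √12 / ((k : ℝ) * ((n : ℝ) + 1)) *
      √(((k : ℝ) / (k + 1)) ^ 2 * ((k : ℝ) / (k + 2))) := by
  have hk' : (0 : ℝ) < k := by exact_mod_cast hk
  have h : 12 * (k : ℝ) / (((k : ℝ) + 1) ^ 2 * ((k : ℝ) + 2)) =
      12 * (((k : ℝ) / (k + 1)) ^ 2 * ((k : ℝ) / (k + 2))) / (k : ℝ) ^ 2 := by
    field_simp
  rw [factor_uniform01 n hk, h, Real.sqrt_div' _ (by positivity), Real.sqrt_sq hk'.le,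
    Real.sqrt_mul (by norm_num)]
  field_simp

lemma factor_uniform01_le (n : ℕ) {k : ℕ} (hk : 1 ≤ k) :
    factor uniform01 n k ≤ √12 / ((k : ℝ) * ((n : ℝ) + 1)) := by
  rw [factor_uniform01_eq n hk]
  refine mul_le_of_le_one_right (by positivity) (Real.sqrt_le_one.2 ?_)
  have h1 : (k : ℝ) / (k + 1) ≤ 1 := div_le_one_of_le₀ (by linarith) (by positivity)
  have h2 : (k : ℝ) / (k + 2) ≤ 1 := div_le_one_of_le₀ (by linarith) (by positivity)
  exact mul_le_one₀ (pow_le_one₀ (by positivity) h1) (by positivity) h2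

lemma tendsto_factor_uniform01_ratio (n : ℕ) :
    Tendsto (fun k : ℕ => factor uniform01 n k / (√12 / ((k : ℝ) * ((n : ℝ) + 1)))) atTop (𝓝 1) := by
  have h : Tendsto (fun k : ℕ => √(((k : ℝ) / (k + 1)) ^ 2 * ((k : ℝ) / (k + 2)))) atTop (𝓝 1) := by
    have := (((tendsto_natCast_div_add_atTop (1 : ℝ)).pow 2).mul
      (tendsto_natCast_div_add_atTop (2 : ℝ))).sqrt
    simpa using this
  refine h.congr' ?_
  filter_upwards [eventually_ge_atTop 1] with k hk
  have hk' : (0 : ℝ) < k := by exact_mod_cast hk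
  rw [factor_uniform01_eq n hk, mul_div_cancel_left₀]
  positivity

end Uniform

lemma abs_sqrt_twelve_sub_lt : |√12 - (3.464 : ℝ)| < 0.0005 := by
  have h1 : (3.4636 : ℝ) < √12 := Real.lt_sqrt_of_sq_lt (by norm_num)
  have h2 : √12 < (3.4644 : ℝ) := (Real.sqrt_lt' (by norm_num)).2 (by norm_num)
  rw [abs_lt]
  constructor <;> linarith

end Delegation

end

theorem mainTheorem6 {Ω : Type*} [MeasurableSpace Ω] (n : ℕ) (hn : 2 ≤ n)
    (x : Ω → ℝ) (hx : Measurable x) (hxpos : ∀ v, 0 < x v) :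
    -- one mechanism, fixed before the prior, the number of solutions and the agents' utilities
    (∃ M : Delegation.MSPM n Ω,
      ∀ (k : ℕ), 1 ≤ k → ∀ (P : Measure Ω), IsProbabilityMeasure P →
        Delegation.HasNondecreasingDensity (P.map x) →
        ∀ y : Fin n → Ω → ℝ, (∀ i v, 0 < y i v) →
          M.HasAdditivePoA x y k P (Delegation.factor (P.map x) n k)) ∧
    -- the factor for the uniform distribution on `[0, 1]`
    Delegation.HasNondecreasingDensity Delegation.uniform01 ∧
    (∀ k : ℕ, 1 ≤ k →
      Delegation.factor Delegation.uniform01 n k =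
          1 / ((n : ℝ) + 1) * √(12 * (k : ℝ) / (((k : ℝ) + 1) ^ 2 * ((k : ℝ) + 2))) ∧
        Delegation.factor Delegation.uniform01 n k ≤ √12 / ((k : ℝ) * ((n : ℝ) + 1))) ∧
    Tendsto (fun k : ℕ =>
        Delegation.factor Delegation.uniform01 n k / (√12 / ((k : ℝ) * ((n : ℝ) + 1))))
      atTop (𝓝 1) ∧
    |√12 - (3.464 : ℝ)| < 0.0005 := by

  refine ⟨⟨Delegation.openMSPM n (by omega) Ω, fun k hk P _ hP y hy =>
    Delegation.hasAdditivePoA_factor (fun _ => rfl) hx hxpos hy hn hk hP⟩,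
    Delegation.hasNondecreasingDensity_uniform01,
    fun k hk => ⟨Delegation.factor_uniform01 n hk, Delegation.factor_uniform01_le n hk⟩,
    Delegation.tendsto_factor_uniform01_ratio n, Delegation.abs_sqrt_twelve_sub_lt⟩
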